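/- Let $K$ be a field of arbitrary characteristic, let $n \ge 3$, and let $R = K[x_1,\dots,x_n]$ with the standard grading. An ideal $I \subseteq R$ is called Artinian if it is homogeneous and $R/I$ is Artinian; $\mu(I)$ denotes its minimal number of generators. An Artinian ideal $I$ has the weak Lefschetz property (WLP) if there is a linear form $L \in [R/I]_1$ such that for every $d$ the multiplication map $\times L : [R/I]_{d} \to [R/I]_{d+1}$ is injective or surjective. Let $A(n)$ be the largest integer $m \ge n$, if it exists, such that every Artinian ideal $I \subseteq R$ with $\mu(I) \le m$ has the WLP. Then: 1. There is an Artinian almost complete intersection in $R$, that is, an Artinian ideal $I \subseteq R$ with $\mu(I) = n+1$, that fails to have the WLP. 2. If $A(n)$ exists, then $A(n) = n$. -/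

import Mathlib

open MvPolynomial

namespace WeakLefschetz

attribute [local instance] MvPolynomial.gradedAlgebra

/-- The degree `d` component `[R/I]_d` of the quotient of the polynomial ring `R = K[x₁, …, xₙ]`
(standard grading) by the ideal `I`: the image in `R/I` of the space of forms of degree `d`. -/
noncomputable def component {K : Type*} [Field K] {n : ℕ} (I : Ideal (MvPolynomial (Fin n) K))
    (d : ℕ) : Submodule K (MvPolynomial (Fin n) K ⧸ I) :=
  (homogeneousSubmodule (Fin n) K d).map (Ideal.Quotient.mkₐ K I).toLinearMap

theorem mul_mem_component {K : Type*} [Field K] {n : ℕ} (I : Ideal (MvPolynomial (Fin n) K))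
    {ℓ : MvPolynomial (Fin n) K ⧸ I} (hl : ℓ ∈ component I 1) (d : ℕ)
    {a : MvPolynomial (Fin n) K ⧸ I} (ha : a ∈ component I d) :
    ℓ * a ∈ component I (d + 1) := by
  obtain ⟨p, hp, rfl⟩ := hl
  obtain ⟨q, hq, rfl⟩ := ha
  refine ⟨p * q, ?_, map_mul (Ideal.Quotient.mkₐ K I) p q⟩
  have hpq := IsHomogeneous.mul hp hq
  rw [add_comm] at hpq
  exact hpq

/-- Multiplication by an element `ℓ` of `[R/I]_1`, as a `K`-linear map `[R/I]_d → [R/I]_{d+1}`. -/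
noncomputable def mulMap {K : Type*} [Field K] {n : ℕ} (I : Ideal (MvPolynomial (Fin n) K))
    (ℓ : component I 1) (d : ℕ) : component I d →ₗ[K] component I (d + 1) :=
  (LinearMap.mulLeft K (ℓ : MvPolynomial (Fin n) K ⧸ I)).restrict
    fun _ ha => mul_mem_component I ℓ.2 d ha

/-- `R/I` has the weak Lefschetz property: there is a linear form `ℓ ∈ [R/I]_1` such that
each multiplication map `×ℓ : [R/I]_d → [R/I]_{d+1}` has maximal rank, i.e. is injective or
surjective. (In negative degrees the components vanish, so nothing is lost by `d : ℕ`.) -/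
def HasWLP {K : Type*} [Field K] {n : ℕ} (I : Ideal (MvPolynomial (Fin n) K)) : Prop :=
  ∃ ℓ : component I 1, ∀ d : ℕ,
    Function.Injective (mulMap I ℓ d) ∨ Function.Surjective (mulMap I ℓ d)

/-- `I` is an Artinian ideal of the standard graded ring `R = K[x₁, …, xₙ]`: it is homogeneous and
`R/I` is Artinian. -/
def IsArtinianIdeal {K : Type*} [Field K] {n : ℕ} (I : Ideal (MvPolynomial (Fin n) K)) : Prop :=
  I.IsHomogeneous (homogeneousSubmodule (Fin n) K) ∧ IsArtinianRing (MvPolynomial (Fin n) K ⧸ I)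

/-- Every Artinian ideal `I ⊆ K[x₁, …, xₙ]` with number of generators `μ(I) ≤ m` has the WLP. Here
`μ(I)`, the minimal number of generators, is `Submodule.spanFinrank I`. -/
def WLPUpTo (K : Type*) [Field K] (n m : ℕ) : Prop :=
  ∀ I : Ideal (MvPolynomial (Fin n) K),
    IsArtinianIdeal I → Submodule.spanFinrank I ≤ m → HasWLP I

/-- The number `A(n)` (for the field `K`) exists and equals `a`: `a` is the largest integer `m ≥ n`
such that every Artinian ideal of `K[x₁, …, xₙ]` with at most `m` generators has the WLP. Proper
Artinian ideals have at least `n` generators, so smaller values of `m` carry no information; if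
already some Artinian complete intersection (`n` generators) fails the WLP, `A(n)` does not
exist. -/
def IsA (K : Type*) [Field K] (n a : ℕ) : Prop :=
  IsGreatest {m : ℕ | n ≤ m ∧ WLPUpTo K n m} a

/-- `I` is an Artinian almost complete intersection in `K[x₁, …, xₙ]`: an Artinian ideal that is
minimally generated by `n + 1` elements. For `n ≥ 1` such an ideal is proper (the unit ideal has
`μ = 1`), hence of codimension `n`, and `n + 1` is one more than its codimension. -/
def IsArtinianACI {K : Type*} [Field K] {n : ℕ} (I : Ideal (MvPolynomial (Fin n) K)) : Prop :=
  IsArtinianIdeal I ∧ Submodule.spanFinrank I = n + 1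

end WeakLefschetz

/-! The witness for both claims is I = (x₁ⁿ, …, xₙⁿ, x₁⋯xₙ). Its n + 1 monomial generators form an
antichain, so μ(I) = n + 1. It fails the WLP in passing from degree n(n-1)/2 - 1 to n(n-1)/2, and
hence every a > n is excluded as a value of A(n).

Surjectivity fails because of a Vandermonde-type functional. For L = x₁ + ⋯ + xₙ, take f ↦ ∑ sgn(σ)
[x^σ] f over all permutations σ of {0, …, n-1}. It kills I, since each x^σ has exponents below n and
one exponent 0. It kills L·x^β, since x^β·xᵢ = x^σ forces β to have two equal exponents, so that the
terms cancel in pairs of opposite sign. For L = ∑ aᵢxᵢ, weights absorb the nonzero aᵢ, and only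
permutations giving the support of a the smallest values are kept (`vandermondeDual_linear_mul`).

Injectivity fails because the Hilbert function does not increase at this step: an injective map
would then be surjective. With A = 1 + ⋯ + tⁿ⁻¹ and B = A - 1, the Hilbert series is Aⁿ - Bⁿ = ∑
AⁱBⁿ⁻¹⁻ⁱ, a sum of symmetric unimodal polynomials. Only Bⁿ⁻¹ can rise there, and the fall of A²Bⁿ⁻³
compensates for it (`coeff_geom_sum_pow_sub_le`). No step depends on the characteristic. -/

namespace Polynomial

/-! ### Symmetric unimodal polynomials. -/

/-- A polynomial with nonnegative integer coefficients `c₀, …, cₛ` that are symmetric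
(`cᵢ = cₛ₋ᵢ`) and unimodal. -/
structure IsSymmUnimodal (f : ℤ[X]) (s : ℕ) : Prop where
  natDegree_le : f.natDegree ≤ s
  nonneg : ∀ i, 0 ≤ f.coeff i
  symm : ∀ i j, i + j = s → f.coeff i = f.coeff j
  -- Here j may lie beyond the centre s/2, as long as it is no farther from it than i.
  mono : ∀ i j, i ≤ j → i + j ≤ s → f.coeff i ≤ f.coeff j

theorem IsSymmUnimodal.one : IsSymmUnimodal 1 0 where
  natDegree_le := by simp
  nonneg i := by rw [coeff_one]; split_ifs <;> simp
  symm i j h := by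
    obtain ⟨rfl, rfl⟩ : i = 0 ∧ j = 0 := by omega
    rfl
  mono i j h h' := by
    obtain ⟨rfl, rfl⟩ : i = 0 ∧ j = 0 := by omega
    rfl

theorem IsSymmUnimodal.X_mul {f : ℤ[X]} {s : ℕ} (hf : IsSymmUnimodal f s) :
    IsSymmUnimodal (X * f) (s + 2) where
  natDegree_le := by
    refine natDegree_mul_le.trans ?_
    have := hf.natDegree_le
    have := natDegree_X_le (R := ℤ)
    omega
  nonneg i := by
    cases i with
    | zero => simp
    | succ i => rw [coeff_X_mul]; exact hf.nonneg i
  symm i j h := by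
    have h0 : (X * f).coeff (s + 2) = 0 := by
      rw [coeff_X_mul]
      exact coeff_eq_zero_of_natDegree_lt (by have := hf.natDegree_le; omega)
    rcases i with _ | i
    · obtain rfl : j = s + 2 := by omega
      rw [h0]; simp
    · rcases j with _ | j
      · rw [h, h0]; simp
      · rw [coeff_X_mul, coeff_X_mul]
        exact hf.symm i j (by omega)
  mono i j h h' := by
    rcases i with _ | i
    · rw [mul_coeff_zero, coeff_X_zero, zero_mul]
      cases j with
      | zero => simp
      | succ j => rw [coeff_X_mul]; exact hf.nonneg j
    · obtain ⟨j, rfl⟩ : ∃ k, j = k + 1 := ⟨j - 1, by omega⟩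
      rw [coeff_X_mul, coeff_X_mul]
      exact hf.mono i j (by omega) (by omega)

/-- Comes from the telescoping (X - 1)(1 + ⋯ + X^(k-1)) = X^k - 1; it reduces monotonicity of the
product to comparing two coefficients of f. -/
theorem coeff_mul_geom_sum_succ (f : ℤ[X]) (k j : ℕ) :
    (f * ∑ i ∈ Finset.range k, X ^ i).coeff (j + 1) =
      (f * ∑ i ∈ Finset.range k, X ^ i).coeff j + f.coeff (j + 1) -
        (if k ≤ j + 1 then f.coeff (j + 1 - k) else 0) := by
  have h : (f * ∑ i ∈ Finset.range k, (X : ℤ[X]) ^ i) * X + f =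
      (f * ∑ i ∈ Finset.range k, X ^ i) + f * X ^ k := by
    have := geom_sum_mul (X : ℤ[X]) k
    linear_combination f * this
  have h2 := congrArg (fun p => coeff p (j + 1)) h
  simp only [coeff_add, coeff_mul_X, coeff_mul_X_pow'] at h2
  linarith

theorem IsSymmUnimodal.mul_geom_sum {f : ℤ[X]} {s : ℕ} (hf : IsSymmUnimodal f s) (k : ℕ) :
    IsSymmUnimodal (f * ∑ i ∈ Finset.range (k + 1), X ^ i) (s + k) := by
  have hdg : (∑ i ∈ Finset.range (k + 1), (X : ℤ[X]) ^ i).natDegree ≤ k := by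
    refine natDegree_sum_le_of_forall_le _ _ fun i hi => ?_
    rw [natDegree_X_pow]
    have := Finset.mem_range.1 hi
    omega
  -- Symmetry is invariance under `reflect`, which is multiplicative.
  have hrefl : (∑ i ∈ Finset.range (k + 1), (X : ℤ[X]) ^ i).reflect k =
      ∑ i ∈ Finset.range (k + 1), X ^ i := by
    ext j
    rw [coeff_reflect]
    simp only [finsetSum_coeff, coeff_X_pow, Finset.sum_ite_eq, Finset.mem_range]
    by_cases hj : j ≤ k
    · rw [revAt_le hj, if_pos (by omega), if_pos (by omega)]
    · rw [revAt_eq_self_of_lt (by omega)]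
  have hfr : f.reflect s = f := by
    ext j
    rw [coeff_reflect]
    by_cases hj : j ≤ s
    · rw [revAt_le hj]
      exact hf.symm _ _ (by omega)
    · rw [revAt_eq_self_of_lt (by omega)]
  have hg0 : ∀ i, 0 ≤ (f * ∑ i ∈ Finset.range (k + 1), X ^ i).coeff i := fun i => by
    rw [coeff_mul]
    refine Finset.sum_nonneg fun x _ => mul_nonneg (hf.nonneg _) ?_
    simp only [finsetSum_coeff, coeff_X_pow, Finset.sum_ite_eq, Finset.mem_range]
    split_ifs <;> simp
  have hsymm : ∀ i j, i + j = s + k → (f * ∑ i ∈ Finset.range (k + 1), X ^ i).coeff i =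
      (f * ∑ i ∈ Finset.range (k + 1), X ^ i).coeff j := by
    intro i j hij
    have h := reflect_mul f (∑ i ∈ Finset.range (k + 1), (X : ℤ[X]) ^ i) hf.natDegree_le hdg
    rw [hfr, hrefl] at h
    have h2 := congrArg (fun p => coeff p i) h
    simp only [coeff_reflect] at h2
    rw [revAt_le (by omega), show s + k - i = j by omega] at h2
    exact h2.symm
  refine ⟨natDegree_mul_le.trans (add_le_add hf.natDegree_le hdg), hg0, hsymm, ?_⟩
  · have hlow : ∀ i j, i ≤ j → j + j ≤ s + k + 1 →
        (f * ∑ i ∈ Finset.range (k + 1), X ^ i).coeff i ≤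
          (f * ∑ i ∈ Finset.range (k + 1), X ^ i).coeff j := by
      intro i j hij
      induction j, hij using Nat.le_induction with
      | base => exact fun _ => le_rfl
      | succ m hm ih =>
        intro hs
        refine (ih (by omega)).trans ?_
        rw [coeff_mul_geom_sum_succ]
        -- The indices m - k and m + 1 sum to 2m + 1 - k ≤ s, within the range of `mono`.
        have : (if k + 1 ≤ m + 1 then f.coeff (m + 1 - (k + 1)) else 0) ≤ f.coeff (m + 1) := by
          split_ifs with hk
          · exact hf.mono _ _ (by omega) (by omega)
          · exact hf.nonneg _
        linarith
    intro i j hij hs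
    by_cases hj : j + j ≤ s + k + 1
    · exact hlow i j hij hj
    · rw [hsymm j (s + k - j) (by omega)]
      exact hlow i _ (by omega) (by omega)

/-- The bound on s says that d + 1 is at least as far from the centre s/2 as d. -/
theorem IsSymmUnimodal.coeff_le_coeff_pred {f : ℤ[X]} {s : ℕ} (hf : IsSymmUnimodal f s) {d : ℕ}
    (hd : s ≤ 2 * d + 1) : f.coeff (d + 1) ≤ f.coeff d := by
  by_cases h : d + 1 ≤ s
  · rw [hf.symm (d + 1) (s - (d + 1)) (by omega)]
    exact hf.mono _ _ (by omega) (by omega)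
  · rw [coeff_eq_zero_of_natDegree_lt (by have := hf.natDegree_le; omega)]
    exact hf.nonneg d

theorem IsSymmUnimodal.mul_geom_sum_pow {f : ℤ[X]} {s : ℕ} (hf : IsSymmUnimodal f s) (k i : ℕ) :
    IsSymmUnimodal (f * (∑ i ∈ Finset.range (k + 1), X ^ i) ^ i) (s + i * k) := by
  induction i with
  | zero => simpa using hf
  | succ i ih =>
    rw [pow_succ, ← mul_assoc, add_mul, one_mul, ← add_assoc]
    exact ih.mul_geom_sum k

theorem IsSymmUnimodal.mul_X_mul_geom_sum_pow {f : ℤ[X]} {s : ℕ} (hf : IsSymmUnimodal f s)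
    (k i : ℕ) :
    IsSymmUnimodal (f * (X * ∑ i ∈ Finset.range (k + 1), X ^ i) ^ i) (s + i * (k + 2)) := by
  induction i with
  | zero => simpa using hf
  | succ i ih =>
    have h := (ih.mul_geom_sum k).X_mul
    rw [pow_succ, ← mul_assoc]
    convert h using 1 <;> ring

/-! ### The key inequality between Hilbert series coefficients. -/

/-- The Hilbert function of `K[x₁, …, xₙ]/(x₁ⁿ, …, xₙⁿ, x₁⋯xₙ)` does not increase from degree
`n(n-1)/2 - 1` to degree `n(n-1)/2`. -/
theorem coeff_geom_sum_pow_sub_le {k d : ℕ} (hd : 2 * (d + 1) = (k + 3) * (k + 2)) :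
    ((∑ i ∈ Finset.range (k + 3), (X : ℤ[X]) ^ i) ^ (k + 3) -
        (X * ∑ i ∈ Finset.range (k + 2), X ^ i) ^ (k + 3)).coeff (d + 1) ≤
      ((∑ i ∈ Finset.range (k + 3), (X : ℤ[X]) ^ i) ^ (k + 3) -
        (X * ∑ i ∈ Finset.range (k + 2), X ^ i) ^ (k + 3)).coeff d := by
  have hAB : ∑ i ∈ Finset.range (k + 3), (X : ℤ[X]) ^ i =
      X * ∑ i ∈ Finset.range (k + 2), X ^ i + 1 := by
    rw [Finset.sum_range_succ', Finset.mul_sum, pow_zero]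
    simp only [pow_succ']
  -- Relates A² and B² so that A²Bᵏ and Bᵏ⁺² can be compared; it is checked after multiplying by (X
  -- - 1)².
  have hsq : X * (∑ i ∈ Finset.range (k + 3), (X : ℤ[X]) ^ i) ^ 2 =
      (X * ∑ i ∈ Finset.range (k + 2), X ^ i) ^ 2 +
        X * ∑ i ∈ Finset.range (2 * k + 4 + 1), X ^ i := by
    have h1 := geom_sum_mul (X : ℤ[X]) (k + 3)
    have h2 := geom_sum_mul (X : ℤ[X]) (k + 2)
    have h3 := geom_sum_mul (X : ℤ[X]) (2 * k + 4 + 1)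
    have hX : (X - 1 : ℤ[X]) ≠ 0 := X_sub_C_ne_zero (1 : ℤ)
    refine mul_right_cancel₀ (pow_ne_zero 2 hX) ?_
    have e1 : X * (∑ i ∈ Finset.range (k + 3), (X : ℤ[X]) ^ i) ^ 2 * (X - 1) ^ 2 =
      X * ((∑ i ∈ Finset.range (k + 3), (X : ℤ[X]) ^ i) * (X - 1)) ^ 2 := by ring
    have e2 : ((X * ∑ i ∈ Finset.range (k + 2), (X : ℤ[X]) ^ i) ^ 2 +
        X * ∑ i ∈ Finset.range (2 * k + 4 + 1), X ^ i) * (X - 1) ^ 2 =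
      (X * ((∑ i ∈ Finset.range (k + 2), (X : ℤ[X]) ^ i) * (X - 1))) ^ 2 +
        X * ((∑ i ∈ Finset.range (2 * k + 4 + 1), X ^ i) * (X - 1)) * (X - 1) := by ring
    rw [e1, e2, h1, h2, h3]
    ring
  set A := ∑ i ∈ Finset.range (k + 3), (X : ℤ[X]) ^ i with hA
  set B := X * ∑ i ∈ Finset.range (k + 2), (X : ℤ[X]) ^ i with hB
  set E := ∑ i ∈ Finset.range (2 * k + 4 + 1), (X : ℤ[X]) ^ i with hE
  -- Factorisation of a difference of powers, with A - B = 1; the three terms with the fewest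
  -- factors A are split off.
  have hpow : A ^ (k + 3) - B ^ (k + 3) =
      (∑ i ∈ Finset.range k, A ^ (i + 3) * B ^ (k + 2 - (i + 3))) + A ^ 2 * B ^ k +
        A * B ^ (k + 1) + B ^ (k + 2) := by
    have h := (Commute.all A B).geom_sum₂_mul (k + 3)
    rw [show A - B = 1 by rw [hAB]; ring, mul_one] at h
    rw [← h, Finset.sum_range_succ', Finset.sum_range_succ', Finset.sum_range_succ']
    simp
  have hAB' : ∀ i j, IsSymmUnimodal (A ^ i * B ^ j) (i * (k + 2) + j * (k + 3)) := by
    intro i j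
    have h := (IsSymmUnimodal.one.mul_geom_sum_pow (k + 2) i).mul_X_mul_geom_sum_pow (k + 1) j
    rwa [one_mul, zero_add] at h
  have hE' : IsSymmUnimodal (E * B ^ k) (2 * k + 4 + k * (k + 3)) := by
    have h := (IsSymmUnimodal.one.mul_geom_sum (2 * k + 4)).mul_X_mul_geom_sum_pow (k + 1) k
    rwa [one_mul, zero_add] at h
  obtain ⟨d, rfl⟩ : ∃ e, d = e + 1 := by
    rcases d with _ | d
    · nlinarith
    · exact ⟨d, rfl⟩
  -- For i + j = n - 1, AⁱBʲ has centre ((n-1)² + j)/2, which is low enough exactly when j ≤ n - 2.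
  have htail : ∀ i ∈ Finset.range k, (A ^ (i + 3) * B ^ (k + 2 - (i + 3))).coeff (d + 1 + 1) ≤
      (A ^ (i + 3) * B ^ (k + 2 - (i + 3))).coeff (d + 1) := by
    intro i hi
    have hi := Finset.mem_range.1 hi
    obtain ⟨j, rfl⟩ : ∃ j, k = i + 1 + j := ⟨k - (i + 1), by omega⟩
    rw [show i + 1 + j + 2 - (i + 3) = j by omega]
    exact (hAB' _ _).coeff_le_coeff_pred (by nlinarith)
  have h1 : (A * B ^ (k + 1)).coeff (d + 1 + 1) ≤ (A * B ^ (k + 1)).coeff (d + 1) := by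
    have h := hAB' 1 (k + 1)
    rw [pow_one] at h
    exact h.coeff_le_coeff_pred (by nlinarith)
  -- Bᵏ⁺² is centred at d + 2 and may rise. A²Bᵏ is centred at d + 1, so its coefficients at d + 2
  -- and d agree; by `hsq` the total change is minus the rise of E·Bᵏ from d to d + 1.
  have h2 : (A ^ 2 * B ^ k).coeff (d + 1 + 1) + (B ^ (k + 2)).coeff (d + 1 + 1) ≤
      (A ^ 2 * B ^ k).coeff (d + 1) + (B ^ (k + 2)).coeff (d + 1) := by
    have hX : X * (A ^ 2 * B ^ k) = B ^ (k + 2) + X * (E * B ^ k) := by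
      linear_combination B ^ k * hsq
    have c1 := congrArg (fun p => coeff p (d + 1 + 1)) hX
    have c2 := congrArg (fun p => coeff p (d + 1)) hX
    simp only [coeff_add, coeff_X_mul] at c1 c2
    have hs := (hAB' 2 k).symm (d + 1 + 1) d (by nlinarith)
    have hm := hE'.mono d (d + 1) (by omega) (by nlinarith)
    linarith
  rw [hpow]
  simp only [coeff_add, finsetSum_coeff]
  have := Finset.sum_le_sum htail
  linarith

end Polynomial

namespace WeakLefschetz

variable {K : Type*} [Field K] {n : ℕ}

/-! ### Monomial ideals: generators and bases of the graded pieces. -/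

/-- The ideal generated by the monomials with exponent vectors in `S`. -/
noncomputable def monomialIdeal (K : Type*) [Field K] {n : ℕ} (S : Set (Fin n →₀ ℕ)) :
    Ideal (MvPolynomial (Fin n) K) :=
  Ideal.span ((fun s => monomial s (1 : K)) '' S)

theorem mem_monomialIdeal {S : Set (Fin n →₀ ℕ)} {f : MvPolynomial (Fin n) K} :
    f ∈ monomialIdeal K S ↔ ∀ α ∈ f.support, ∃ s ∈ S, s ≤ α :=
  mem_ideal_span_monomial_image

theorem coeff_eq_zero_of_mem_monomialIdeal {S : Set (Fin n →₀ ℕ)} {f : MvPolynomial (Fin n) K}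
    (hf : f ∈ monomialIdeal K S) {α : Fin n →₀ ℕ} (hα : ∀ s ∈ S, ¬ s ≤ α) : coeff α f = 0 := by
  by_contra h
  obtain ⟨s, hs, hle⟩ := mem_monomialIdeal.1 hf α (mem_support_iff.2 h)
  exact hα s hs hle

theorem monomial_mem_monomialIdeal {S : Set (Fin n →₀ ℕ)} {s α : Fin n →₀ ℕ} (hs : s ∈ S)
    (h : s ≤ α) (c : K) : monomial α c ∈ monomialIdeal K S :=
  mem_monomialIdeal.2 fun β hβ => ⟨s, hs, by
    rwa [Finset.mem_singleton.1 (support_monomial_subset hβ)]⟩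

theorem monomialIdeal_isHomogeneous (S : Set (Fin n →₀ ℕ)) :
    letI := MvPolynomial.gradedAlgebra (σ := Fin n) (R := K)
    (monomialIdeal K S).IsHomogeneous (homogeneousSubmodule (Fin n) K) := by
  let := MvPolynomial.gradedAlgebra (σ := Fin n) (R := K)
  refine Ideal.homogeneous_span _ _ ?_
  rintro _ ⟨s, -, rfl⟩
  exact ⟨s.degree, isHomogeneous_monomial _ rfl⟩

/-- If `S` contains a power of each variable, then the quotient by the monomial ideal of `S` is
Artinian. -/
theorem isArtinianRing_quotient_monomialIdeal {S : Set (Fin n →₀ ℕ)} (m : Fin n → ℕ)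
    (hm : ∀ i, m i ≠ 0) (hS : ∀ i, Finsupp.single i (m i) ∈ S) :
    IsArtinianRing (MvPolynomial (Fin n) K ⧸ monomialIdeal K S) := by
  have hft : Algebra.FiniteType K (MvPolynomial (Fin n) K ⧸ monomialIdeal K S) := inferInstance
  have hX : ∀ i, IsIntegral K (Ideal.Quotient.mkₐ K (monomialIdeal K S) (X i)) := fun i => by
    refine IsIntegral.of_pow (Nat.pos_of_ne_zero (hm i)) ?_
    rw [← map_pow, X_pow_eq_monomial]
    have : Ideal.Quotient.mkₐ K (monomialIdeal K S) (monomial (Finsupp.single i (m i)) 1) = 0 :=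
      Ideal.Quotient.eq_zero_iff_mem.2 (monomial_mem_monomialIdeal (hS i) le_rfl _)
    rw [this]
    exact isIntegral_zero
  have hint : Algebra.IsIntegral K (MvPolynomial (Fin n) K ⧸ monomialIdeal K S) := by
    refine ⟨fun x => ?_⟩
    obtain ⟨p, rfl⟩ := Ideal.Quotient.mkₐ_surjective K (monomialIdeal K S) x
    induction p using MvPolynomial.induction_on with
    | C a => exact isIntegral_algebraMap (x := a)
    | add p q hp hq => rw [map_add]; exact hp.add hq
    | mul_X p i hp => rw [map_mul]; exact hp.mul (hX i)
  have := Algebra.finite_iff_isIntegral_and_finiteType.2 ⟨hint, hft⟩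
  exact IsArtinianRing.of_finite K _

/-- By the antichain condition, s is the only exponent below s occurring in elements of the ideal,
so only the constant term of r contributes. -/
theorem coeff_mul_of_mem_monomialIdeal {S : Set (Fin n →₀ ℕ)} (hS : IsAntichain (· ≤ ·) S)
    {s : Fin n →₀ ℕ} (hs : s ∈ S) (r : MvPolynomial (Fin n) K) {p : MvPolynomial (Fin n) K}
    (hp : p ∈ monomialIdeal K S) : coeff s (r * p) = coeff 0 r * coeff s p := by
  classical
  rw [coeff_mul]
  refine Finset.sum_eq_single (0, s) ?_ ?_
  · rintro ⟨u, v⟩ huv hne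
    have huv := Finset.HasAntidiagonal.mem_antidiagonal.1 huv
    dsimp only at huv ⊢
    by_contra h
    obtain ⟨t, ht, htv⟩ := mem_monomialIdeal.1 hp v (mem_support_iff.2 (right_ne_zero_of_mul h))
    have hvs : v ≤ s := huv ▸ le_add_self
    have hts : t = s := hS.eq ht hs (htv.trans hvs)
    have hv : v = s := le_antisymm hvs (hts ▸ htv)
    subst hv
    exact hne (by rw [add_eq_right.1 huv])
  · intro h
    exact absurd (Finset.HasAntidiagonal.mem_antidiagonal.2 (zero_add s)) h

/-- The minimal number of generators of a monomial ideal is the number of its minimal monomial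
generators. -/
theorem spanFinrank_monomialIdeal {S : Finset (Fin n →₀ ℕ)}
    (hS : IsAntichain (· ≤ ·) (S : Set (Fin n →₀ ℕ))) :
    Submodule.spanFinrank (monomialIdeal K (S : Set (Fin n →₀ ℕ))) = S.card := by
  classical
  refine le_antisymm ?_ ?_
  · refine (Submodule.spanFinrank_span_le_ncard_of_finite (S.finite_toSet.image _)).trans ?_
    exact (Set.ncard_image_le S.finite_toSet).trans (Set.ncard_coe_finset S).le
  · have hfg : (monomialIdeal K (S : Set (Fin n →₀ ℕ))).FG :=
      (isNoetherianRing_iff_ideal_fg _).1 inferInstance _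
    obtain ⟨t, ht, hspan⟩ := Submodule.FG.exists_span_finset_card_eq_spanFinrank hfg
    rw [← ht]
    -- On the ideal, `φ` turns R-combinations into K-combinations, so the images of any generating
    -- set span a space of dimension |S|.
    let φ : MvPolynomial (Fin n) K →ₗ[K] (S → K) := LinearMap.pi fun s => lcoeff K s.1
    have hφ : ∀ p ∈ Submodule.span (MvPolynomial (Fin n) K) (t : Set (MvPolynomial (Fin n) K)),
        φ p ∈ Submodule.span K (t.image φ : Set (S → K)) := by
      intro p hp
      induction hp using Submodule.span_induction with
      | mem x hx => exact Submodule.subset_span (by simpa using ⟨x, hx, rfl⟩)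
      | zero => rw [map_zero]; exact zero_mem _
      | add x y _ _ hx hy => rw [map_add]; exact add_mem hx hy
      | smul r x hx ih =>
        have : φ (r • x) = coeff 0 r • φ x := by
          ext s
          exact coeff_mul_of_mem_monomialIdeal hS s.2 r (hspan ▸ hx)
        rw [this]
        exact Submodule.smul_mem _ _ ih
    have htop : Submodule.span K (t.image φ : Set (S → K)) = ⊤ := by
      rw [eq_top_iff, ← (Pi.basisFun K S).span_eq, Submodule.span_le]
      rintro _ ⟨s, rfl⟩
      have := hφ (monomial s.1 1) (hspan ▸ monomial_mem_monomialIdeal s.2 le_rfl 1)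
      have hs : φ (monomial s.1 1) = Pi.basisFun K S s := by
        ext u
        by_cases hus : u = s
        · subst hus
          simp [φ]
        · have : s.1 ≠ u.1 := fun h => hus (Subtype.ext h.symm)
          simp [φ, coeff_monomial, hus, this]
      rwa [hs] at this
    have h1 := finrank_span_finset_le_card (R := K) (t.image φ)
    rw [Set.finrank, htop, finrank_top, Module.finrank_fintype_fun_eq_card, Fintype.card_coe] at h1
    exact h1.trans Finset.card_image_le

/-- The images of the monomials of degree `d` outside a monomial ideal form a basis of the
degree `d` component of the quotient. -/
theorem nonempty_basis_component_monomialIdeal (S : Set (Fin n →₀ ℕ)) (d : ℕ)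
    (T : Finset (Fin n →₀ ℕ)) (hT : ∀ α, α ∈ T ↔ α.degree = d ∧ ∀ s ∈ S, ¬ s ≤ α) :
    Nonempty (Module.Basis T K (component (monomialIdeal K S) d)) := by
  let b : T → MvPolynomial (Fin n) K ⧸ monomialIdeal K S :=
    fun α => Ideal.Quotient.mkₐ K (monomialIdeal K S) (monomial α.1 1)
  have hli : LinearIndependent K b := by
    rw [Fintype.linearIndependent_iff]
    intro g hg α
    have hmem : ∑ β : T, g β • monomial β.1 (1 : K) ∈ monomialIdeal K S := by
      rw [← Ideal.Quotient.eq_zero_iff_mem, ← Ideal.Quotient.mkₐ_eq_mk K, map_sum]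
      simpa only [map_smul] using hg
    have h := coeff_eq_zero_of_mem_monomialIdeal hmem ((hT α).1 α.2).2
    simpa [coeff_sum, coeff_monomial, Subtype.ext_iff.symm] using h
  have hspan : component (monomialIdeal K S) d = Submodule.span K (Set.range b) := by
    refine le_antisymm ?_ ?_
    · rintro _ ⟨f, hf, rfl⟩
      rw [f.as_sum, map_sum]
      refine Submodule.sum_mem _ fun α hα => ?_
      have hdeg : α.degree = d := by
        by_contra h
        exact (mem_support_iff.1 hα) (IsHomogeneous.coeff_eq_zero hf h)
      by_cases hstd : ∀ s ∈ S, ¬ s ≤ α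
      · have : monomial α (coeff α f) = coeff α f • monomial α (1 : K) := by
          rw [smul_monomial, smul_eq_mul, mul_one]
        rw [this, map_smul]
        exact Submodule.smul_mem _ _ (Submodule.subset_span ⟨⟨α, (hT α).2 ⟨hdeg, hstd⟩⟩, rfl⟩)
      · push Not at hstd
        obtain ⟨s, hs, hle⟩ := hstd
        have : (Ideal.Quotient.mkₐ K (monomialIdeal K S)).toLinearMap
            (monomial α (coeff α f)) = 0 :=
          Ideal.Quotient.eq_zero_iff_mem.2 (monomial_mem_monomialIdeal hs hle _)
        rw [this]
        exact zero_mem _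
    · rw [Submodule.span_le]
      rintro _ ⟨α, rfl⟩
      exact ⟨monomial α.1 1, isHomogeneous_monomial _ ((hT α).1 α.2).1, rfl⟩
  exact ⟨(Module.Basis.span hli).map (LinearEquiv.ofEq _ _ hspan.symm)⟩

/-! ### The ideal of n-th powers and the product of the variables. -/

/-- The exponent vectors of the generators `x₁ⁿ, …, xₙⁿ, x₁⋯xₙ`. -/
noncomputable def powersAndProduct (n : ℕ) : Finset (Fin n →₀ ℕ) :=
  insert (Finsupp.equivFunOnFinite.symm fun _ => 1)
    (Finset.univ.image fun i => Finsupp.single i n)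

theorem isAntichain_powersAndProduct (hn : 2 ≤ n) :
    IsAntichain (· ≤ ·) (powersAndProduct n : Set (Fin n →₀ ℕ)) := by
  have h1 : ∀ i : Fin n, ¬ Finsupp.single i n ≤ Finsupp.equivFunOnFinite.symm fun _ => 1 := by
    intro i h
    have := h i
    simp at this
    omega
  have h2 : ∀ i : Fin n, ¬ (Finsupp.equivFunOnFinite.symm fun _ => 1) ≤ Finsupp.single i n := by
    intro i h
    have : Nontrivial (Fin n) := Fin.nontrivial_iff_two_le.2 hn
    obtain ⟨j, hj⟩ := exists_ne i
    have := h j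
    simp [hj.symm] at this
  have h3 : ∀ i j : Fin n, Finsupp.single i n ≤ Finsupp.single j n → i = j := by
    intro i j h
    by_contra hij
    have := h i
    simp [Ne.symm hij] at this
    omega
  intro s hs t ht hst hle
  simp only [powersAndProduct, Finset.coe_insert, Finset.coe_image, Finset.coe_univ,
    Set.image_univ, Set.mem_insert_iff, Set.mem_range] at hs ht
  rcases hs with rfl | ⟨i, rfl⟩ <;> rcases ht with rfl | ⟨j, rfl⟩
  · exact hst rfl
  · exact h2 j hle
  · exact h1 i hle
  · exact hst (by rw [h3 i j hle])

theorem card_powersAndProduct (hn : 2 ≤ n) : (powersAndProduct n).card = n + 1 := by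
  rw [powersAndProduct, Finset.card_insert_of_notMem, Finset.card_image_of_injective,
    Finset.card_univ, Fintype.card_fin]
  · exact Finsupp.single_left_injective (by omega)
  · simp only [Finset.mem_image, Finset.mem_univ, true_and, not_exists]
    intro i h
    have := DFunLike.congr_fun h i
    simp at this
    omega

theorem forall_powersAndProduct_not_le_iff {α : Fin n →₀ ℕ} :
    (∀ s ∈ (powersAndProduct n : Set (Fin n →₀ ℕ)), ¬ s ≤ α) ↔
      (∀ i, α i < n) ∧ ∃ i, α i = 0 := by
  simp only [powersAndProduct, Finset.coe_insert, Finset.coe_image, Finset.coe_univ,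
    Set.image_univ, Set.mem_insert_iff, Set.mem_range, forall_eq_or_imp, forall_exists_index,
    forall_apply_eq_imp_iff, Finsupp.single_le_iff, not_le]
  rw [and_comm]
  refine and_congr_right fun _ => ?_
  simp [Finsupp.le_def, Nat.one_le_iff_ne_zero]

/-! ### The Hilbert function -/

theorem coeff_sum_X_pow_pow (A : Finset ℕ) (n d : ℕ) :
    ((∑ a ∈ A, (Polynomial.X : Polynomial ℤ) ^ a) ^ n).coeff d =
      ((Fintype.piFinset fun _ : Fin n => A).filter fun p => ∑ i, p i = d).card := by
  have : (∑ a ∈ A, (Polynomial.X : Polynomial ℤ) ^ a) ^ n =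
      ∏ _i : Fin n, ∑ a ∈ A, (Polynomial.X : Polynomial ℤ) ^ a := by simp
  rw [this, Finset.prod_univ_sum, Polynomial.finsetSum_coeff, Finset.card_filter, Nat.cast_sum]
  refine Finset.sum_congr rfl fun p _ => ?_
  rw [Finset.prod_pow_eq_pow_sum, Polynomial.coeff_X_pow]
  simp [eq_comm]

/-- The exponent vectors of the monomials of degree `d` outside the ideal
`(x₁ⁿ, …, xₙⁿ, x₁⋯xₙ)`. -/
noncomputable def standardExponents (n d : ℕ) : Finset (Fin n →₀ ℕ) :=
  ((Fintype.piFinset fun _ : Fin n => Finset.range n).filter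
    fun p => (∑ i, p i = d) ∧ ∃ i, p i = 0).map Finsupp.equivFunOnFinite.symm.toEmbedding

theorem mem_standardExponents {d : ℕ} {α : Fin n →₀ ℕ} :
    α ∈ standardExponents n d ↔
      α.degree = d ∧ ∀ s ∈ (powersAndProduct n : Set (Fin n →₀ ℕ)), ¬ s ≤ α := by
  rw [forall_powersAndProduct_not_le_iff, standardExponents, Finset.mem_map_equiv]
  simp only [Finset.mem_filter, Fintype.mem_piFinset, Finset.mem_range, Finsupp.degree_eq_sum]
  simp
  tauto

theorem card_standardExponents (n d : ℕ) :
    ((standardExponents n d).card : ℤ) =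
      ((∑ i ∈ Finset.range n, (Polynomial.X : Polynomial ℤ) ^ i) ^ n -
        (Polynomial.X * ∑ i ∈ Finset.range (n - 1), Polynomial.X ^ i) ^ n).coeff d := by
  have hX : (Polynomial.X : Polynomial ℤ) * ∑ i ∈ Finset.range (n - 1), Polynomial.X ^ i =
      ∑ i ∈ Finset.Ico 1 n, Polynomial.X ^ i := by
    rw [Finset.sum_Ico_eq_sum_range, Finset.mul_sum]
    exact Finset.sum_congr rfl fun i _ => by rw [pow_add, pow_one]
  rw [hX, Polynomial.coeff_sub, coeff_sum_X_pow_pow, coeff_sum_X_pow_pow, standardExponents,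
    Finset.card_map, eq_sub_iff_add_eq, ← Nat.cast_add, Nat.cast_inj]
  -- Exponent vectors below n with no zero entry are those counted by the subtracted power.
  rw [← Finset.card_filter_add_card_filter_not (fun p : Fin n → ℕ => ∃ i, p i = 0)
    (s := (Fintype.piFinset fun _ : Fin n => Finset.range n).filter fun p => ∑ i, p i = d),
    Finset.filter_filter, Finset.filter_filter]
  congr 2
  ext p
  simp only [Finset.mem_filter, Fintype.mem_piFinset, Finset.mem_range, Finset.mem_Ico,
    not_exists, Nat.one_le_iff_ne_zero]
  constructor
  · rintro ⟨h, hs⟩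
    exact ⟨fun i => (h i).2, hs, fun i => (h i).1⟩
  · rintro ⟨h, hs, h0⟩
    exact ⟨fun i => ⟨h0 i, h i⟩, hs⟩

theorem card_standardExponents_succ_le (hn : 3 ≤ n) {d : ℕ} (hd : 2 * (d + 1) = n * (n - 1)) :
    (standardExponents n (d + 1)).card ≤ (standardExponents n d).card := by
  obtain ⟨k, rfl⟩ : ∃ k, n = k + 3 := ⟨n - 3, by omega⟩
  have h := Polynomial.coeff_geom_sum_pow_sub_le (k := k) (d := d) hd
  rw [← Nat.cast_le (α := ℤ), card_standardExponents, card_standardExponents]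
  exact h

/-! ### Failure of surjectivity -/

/-- The exponent vector `(σ(1), …, σ(n))` of a permutation `σ` of `{0, …, n - 1}`. -/
noncomputable def permExponent (σ : Equiv.Perm (Fin n)) : Fin n →₀ ℕ :=
  Finsupp.equivFunOnFinite.symm fun i => (σ i : ℕ)

theorem permExponent_apply (σ : Equiv.Perm (Fin n)) (i : Fin n) :
    permExponent σ i = (σ i : ℕ) := rfl

theorem permExponent_injective : Function.Injective (permExponent (n := n)) := fun _ _ h =>
  Equiv.ext fun i => Fin.ext (DFunLike.congr_fun h i)

theorem two_mul_degree_permExponent (σ : Equiv.Perm (Fin n)) :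
    2 * (permExponent σ).degree = n * (n - 1) := by
  rw [Finsupp.degree_eq_sum]
  simp only [permExponent_apply]
  rw [Equiv.sum_comp σ (fun i => (i : ℕ)), Fin.sum_univ_eq_sum_range (fun i => i),
    mul_comm, Finset.sum_range_id_mul_two]

theorem not_le_permExponent [NeZero n] (σ : Equiv.Perm (Fin n)) :
    ∀ s ∈ (powersAndProduct n : Set (Fin n →₀ ℕ)), ¬ s ≤ permExponent σ :=
  forall_powersAndProduct_not_le_iff.2
    ⟨fun i => (σ i).2, σ.symm 0, by rw [permExponent_apply, Equiv.apply_symm_apply, Fin.val_zero]⟩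

open Classical in
/-- The permutations that give the indices in the support of `a` smaller values than the
remaining indices. -/
noncomputable def supportFirstPerms (a : Fin n → K) : Finset (Equiv.Perm (Fin n)) :=
  Finset.univ.filter fun σ => ∀ i j, σ j ≤ σ i → a i ≠ 0 → a j ≠ 0

theorem mem_supportFirstPerms {a : Fin n → K} {σ : Equiv.Perm (Fin n)} :
    σ ∈ supportFirstPerms a ↔ ∀ i j, σ j ≤ σ i → a i ≠ 0 → a j ≠ 0 := by
  simp [supportFirstPerms]

theorem supportFirstPerms_nonempty (a : Fin n → K) : (supportFirstPerms a).Nonempty := by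
  classical
  let f : Fin n → ℕ := fun i => if a i = 0 then 1 else 0
  refine ⟨(Tuple.sort f).symm, mem_supportFirstPerms.2 fun i j hji hi hj => ?_⟩
  have h := Tuple.monotone_sort f hji
  simp [f, hi, hj] at h

/-- The weight `∏ aᵢ^(-αᵢ)`, taken over the support of `a`. -/
noncomputable def weight (a : Fin n → K) (α : Fin n →₀ ℕ) : K :=
  open Classical in ∏ i, (if a i = 0 then 1 else (a i)⁻¹) ^ α i

theorem weight_ne_zero (a : Fin n → K) (α : Fin n →₀ ℕ) : weight a α ≠ 0 := by
  classical
  refine Finset.prod_ne_zero_iff.2 fun i _ => pow_ne_zero _ ?_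
  split_ifs with h
  · exact one_ne_zero
  · exact inv_ne_zero h

/-- Makes the contribution of a monomial xᵢ·x^β independent of i, up to the sign of the permutation.
-/
theorem mul_weight_single_add {a : Fin n → K} {i : Fin n} (hi : a i ≠ 0) (β : Fin n →₀ ℕ) :
    a i * weight a (Finsupp.single i 1 + β) = weight a β := by
  classical
  simp only [weight, Finsupp.add_apply, pow_add, Finset.prod_mul_distrib]
  rw [Finset.prod_eq_single i, ← mul_assoc]
  · simp [hi]
  · intro j _ hj
    simp [hj.symm]
  · simp

/-- The functional dual to the Vandermonde determinant in the variables on the support of `a`. -/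
noncomputable def vandermondeDual (a : Fin n → K) : MvPolynomial (Fin n) K →ₗ[K] K :=
  ∑ σ ∈ supportFirstPerms a,
    ((Equiv.Perm.sign σ : ℤ) * weight a (permExponent σ) : K) • lcoeff K (permExponent σ)

theorem vandermondeDual_apply (a : Fin n → K) (f : MvPolynomial (Fin n) K) :
    vandermondeDual a f = ∑ σ ∈ supportFirstPerms a,
      (Equiv.Perm.sign σ : ℤ) * weight a (permExponent σ) * coeff (permExponent σ) f := by
  simp [vandermondeDual, LinearMap.sum_apply]

theorem vandermondeDual_monomial {a : Fin n → K} {σ : Equiv.Perm (Fin n)}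
    (hσ : σ ∈ supportFirstPerms a) : vandermondeDual a (monomial (permExponent σ) 1) ≠ 0 := by
  rw [vandermondeDual_apply, Finset.sum_eq_single_of_mem σ hσ]
  · rw [coeff_monomial, if_pos rfl, mul_one]
    refine mul_ne_zero ?_ (weight_ne_zero _ _)
    rcases Int.units_eq_one_or (Equiv.Perm.sign σ) with h | h <;> simp [h]
  · intro τ _ hτ
    rw [coeff_monomial, if_neg fun h => hτ (permExponent_injective h).symm, mul_zero]

theorem vandermondeDual_of_mem [NeZero n] (a : Fin n → K) {f : MvPolynomial (Fin n) K}
    (hf : f ∈ monomialIdeal K (powersAndProduct n : Set (Fin n →₀ ℕ))) :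
    vandermondeDual a f = 0 := by
  rw [vandermondeDual_apply]
  refine Finset.sum_eq_zero fun σ _ => ?_
  rw [coeff_eq_zero_of_mem_monomialIdeal hf (not_le_permExponent σ), mul_zero]

/-- The position of the value `σ i - 1` in the permutation `σ`, where `σ = β + eᵢ`. -/
def swapIndex {β : Fin n →₀ ℕ} {i : Fin n} {σ : Equiv.Perm (Fin n)}
    (h : Finsupp.single i 1 + β = permExponent σ) : Fin n :=
  σ.symm ⟨β i, (le_add_self.trans (DFunLike.congr_fun h i).le).trans_lt (σ i).2⟩

theorem apply_swapIndex {β : Fin n →₀ ℕ} {i : Fin n} {σ : Equiv.Perm (Fin n)}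
    (h : Finsupp.single i 1 + β = permExponent σ) : (σ (swapIndex h) : ℕ) = β i := by
  rw [swapIndex, Equiv.apply_symm_apply]

theorem apply_eq_add_one {β : Fin n →₀ ℕ} {i : Fin n} {σ : Equiv.Perm (Fin n)}
    (h : Finsupp.single i 1 + β = permExponent σ) : (σ i : ℕ) = β i + 1 := by
  rw [← permExponent_apply, ← h]
  simp [add_comm]

theorem swapIndex_ne {β : Fin n →₀ ℕ} {i : Fin n} {σ : Equiv.Perm (Fin n)}
    (h : Finsupp.single i 1 + β = permExponent σ) : swapIndex h ≠ i := by
  intro hij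
  have h1 := apply_swapIndex h
  rw [hij, apply_eq_add_one h] at h1
  omega

theorem apply_eq_of_ne {β : Fin n →₀ ℕ} {i k : Fin n} {σ : Equiv.Perm (Fin n)}
    (h : Finsupp.single i 1 + β = permExponent σ) (hk : k ≠ i) : (σ k : ℕ) = β k := by
  rw [← permExponent_apply, ← h]
  simp [hk.symm]

/-- β takes the value σ(i) - 1 at both i and `swapIndex h`; raising either entry gives a
permutation, and the two differ by a transposition. -/
theorem single_swapIndex_add {β : Fin n →₀ ℕ} {i : Fin n} {σ : Equiv.Perm (Fin n)}
    (h : Finsupp.single i 1 + β = permExponent σ) :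
    Finsupp.single (swapIndex h) 1 + β =
      permExponent (σ * Equiv.swap i (swapIndex h)) := by
  have hj := apply_swapIndex h
  have hne := swapIndex_ne h
  have hβ := apply_eq_of_ne h hne
  ext k
  rw [permExponent_apply, Equiv.Perm.mul_apply, Finsupp.add_apply]
  by_cases hkj : k = swapIndex h
  · rw [hkj, Equiv.swap_apply_right, apply_eq_add_one h, Finsupp.single_eq_same]
    omega
  · rw [Finsupp.single_eq_of_ne hkj, zero_add]
    by_cases hki : k = i
    · rw [hki, Equiv.swap_apply_left, hj]
    · rw [Equiv.swap_apply_of_ne_of_ne hki hkj, apply_eq_of_ne h hki]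

theorem swapIndex_swapIndex {β : Fin n →₀ ℕ} {i : Fin n} {σ : Equiv.Perm (Fin n)}
    (h : Finsupp.single i 1 + β = permExponent σ) : swapIndex (single_swapIndex_add h) = i := by
  refine (σ * Equiv.swap i (swapIndex h)).injective (Fin.ext ?_)
  rw [apply_swapIndex (single_swapIndex_add h), Equiv.Perm.mul_apply, Equiv.swap_apply_left]
  exact (apply_eq_of_ne h (swapIndex_ne h)).symm

/-- The nonzero terms are indexed by pairs (σ, i) with β + eᵢ = σ and aᵢ ≠ 0; swapping via
`swapIndex` is a fixed-point-free, sign-reversing involution on them. -/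
theorem vandermondeDual_mul_monomial (a : Fin n → K) (β : Fin n →₀ ℕ) (c : K) :
    vandermondeDual a ((∑ i, C (a i) * X i) * monomial β c) = 0 := by
  classical
  have hexp : (∑ i, C (a i) * X i) * monomial β c =
      ∑ i, monomial (Finsupp.single i 1 + β) (a i * c) := by
    rw [Finset.sum_mul]
    refine Finset.sum_congr rfl fun i _ => ?_
    rw [C_mul_X_eq_monomial, monomial_mul]
  rw [vandermondeDual_apply, hexp]
  simp only [coeff_sum, coeff_monomial, Finset.mul_sum]
  rw [← Finset.sum_product']
  rw [← Finset.sum_filter_add_sum_filter_not _ (fun x : Equiv.Perm (Fin n) × Fin n =>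
    Finsupp.single x.2 1 + β = permExponent x.1 ∧ a x.2 ≠ 0)]
  rw [Finset.sum_eq_zero (s := Finset.filter (fun x => ¬ _) _), add_zero]
  swap
  · intro x hx
    have hx := (Finset.mem_filter.1 hx).2
    split_ifs with h
    · have : a x.2 = 0 := by
        by_contra h'
        exact hx ⟨h, h'⟩
      rw [this, zero_mul, mul_zero]
    · rw [mul_zero]
  have hmem : ∀ x ∈ (supportFirstPerms a ×ˢ Finset.univ).filter
      (fun x : Equiv.Perm (Fin n) × Fin n =>
        Finsupp.single x.2 1 + β = permExponent x.1 ∧ a x.2 ≠ 0),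
      x.1 ∈ supportFirstPerms a ∧ Finsupp.single x.2 1 + β = permExponent x.1 ∧ a x.2 ≠ 0 := by
    intro x hx
    simpa using hx
  refine Finset.sum_involution (fun x hx => (x.1 * Equiv.swap x.2 (swapIndex (hmem x hx).2.1),
    swapIndex (hmem x hx).2.1)) ?_ ?_ ?_ ?_
  · rintro ⟨σ, i⟩ hx
    obtain ⟨hσ, h, hi⟩ := hmem _ hx
    -- The partner index has the smaller value σ(i) - 1, so it lies in the support because σ puts
    -- the support first.
    have hj : a (swapIndex h) ≠ 0 := by
      refine mem_supportFirstPerms.1 hσ i _ (Fin.le_def.2 ?_) hi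
      rw [apply_swapIndex, apply_eq_add_one h]
      omega
    have hterm : ∀ (τ : Equiv.Perm (Fin n)) (k : Fin n) (hk : a k ≠ 0)
        (hτ : Finsupp.single k 1 + β = permExponent τ),
        ((Equiv.Perm.sign τ : ℤ) : K) * weight a (permExponent τ) *
          (if Finsupp.single k 1 + β = permExponent τ then a k * c else 0) =
        ((Equiv.Perm.sign τ : ℤ) : K) * (weight a β * c) := by
      intro τ k hk hτ
      rw [if_pos hτ, ← hτ, ← mul_weight_single_add hk β]
      ring
    dsimp only
    rw [hterm σ i hi h, hterm _ _ hj (single_swapIndex_add h), Equiv.Perm.sign_mul,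
      Equiv.Perm.sign_swap (swapIndex_ne h).symm]
    simp
  · rintro ⟨σ, i⟩ hx _ heq
    exact swapIndex_ne (hmem _ hx).2.1 (congrArg Prod.snd heq)
  · rintro ⟨σ, i⟩ hx
    obtain ⟨hσ, h, hi⟩ := hmem _ hx
    have hj : a (swapIndex h) ≠ 0 := by
      refine mem_supportFirstPerms.1 hσ i _ (Fin.le_def.2 ?_) hi
      rw [apply_swapIndex, apply_eq_add_one h]
      omega
    -- The transposition exchanges two support indices, so the new permutation still puts the
    -- support first.
    have hsw : ∀ k, a (Equiv.swap i (swapIndex h) k) ≠ 0 ↔ a k ≠ 0 := by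
      intro k
      by_cases hki : k = i
      · rw [hki, Equiv.swap_apply_left]; exact iff_of_true hj hi
      · by_cases hkj : k = swapIndex h
        · rw [hkj, Equiv.swap_apply_right]; exact iff_of_true hi hj
        · rw [Equiv.swap_apply_of_ne_of_ne hki hkj]
    refine Finset.mem_filter.2 ⟨Finset.mem_product.2 ⟨?_, Finset.mem_univ _⟩,
      single_swapIndex_add h, hj⟩
    refine mem_supportFirstPerms.2 fun k l hlk hk => ?_
    exact (hsw l).1 (mem_supportFirstPerms.1 hσ _ _ hlk ((hsw k).2 hk))
  · rintro ⟨σ, i⟩ hx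
    have h := (hmem _ hx).2.1
    refine Prod.ext ?_ (swapIndex_swapIndex h)
    dsimp only
    rw [swapIndex_swapIndex h, Equiv.swap_comm, mul_assoc, Equiv.swap_mul_self, mul_one]

theorem vandermondeDual_linear_mul (a : Fin n → K) (q : MvPolynomial (Fin n) K) :
    vandermondeDual a ((∑ i, C (a i) * X i) * q) = 0 := by
  rw [q.as_sum, Finset.mul_sum, map_sum]
  exact Finset.sum_eq_zero fun β _ => vandermondeDual_mul_monomial a β _

theorem eq_sum_C_mul_X_of_isHomogeneous_one {p : MvPolynomial (Fin n) K}
    (hp : p.IsHomogeneous 1) : p = ∑ i, C (coeff (Finsupp.single i 1) p) * X i := by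
  classical
  ext α
  simp only [coeff_sum, C_mul_X_eq_monomial, coeff_monomial]
  by_cases hα : α.degree = 1
  · obtain ⟨i, rfl⟩ : ∃ i, α = Finsupp.single i 1 := by
      simpa using (Finsupp.sum_eq_one_iff α).1 hα
    rw [Finset.sum_eq_single i]
    · simp
    · intro j _ hj
      rw [if_neg fun h => hj (Finsupp.single_left_injective one_ne_zero h)]
    · simp
  · rw [hp.coeff_eq_zero hα, Finset.sum_eq_zero]
    rintro i -
    rw [if_neg]
    rintro rfl
    simp at hα

/-- Multiplication by a linear form on the quotient by `(x₁ⁿ, …, xₙⁿ, x₁⋯xₙ)` is never surjective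
onto degree `n(n-1)/2`. -/
theorem not_surjective_mulMap [NeZero n] {d : ℕ} (hd : 2 * (d + 1) = n * (n - 1))
    (ℓ : component (monomialIdeal K (powersAndProduct n : Set (Fin n →₀ ℕ))) 1) :
    ¬ Function.Surjective
      (mulMap (monomialIdeal K (powersAndProduct n : Set (Fin n →₀ ℕ))) ℓ d) := by
  intro hsurj
  obtain ⟨ℓ, p, hp, rfl⟩ := ℓ
  set a : Fin n → K := fun i => coeff (Finsupp.single i 1) p
  obtain ⟨σ, hσ⟩ := supportFirstPerms_nonempty a
  have hdeg := two_mul_degree_permExponent σ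
  obtain ⟨⟨_, q, hq, rfl⟩, hq'⟩ := hsurj ⟨_, monomial (permExponent σ) 1,
    isHomogeneous_monomial _ (by omega), rfl⟩
  have hmem : p * q - monomial (permExponent σ) 1 ∈
      monomialIdeal K (powersAndProduct n : Set (Fin n →₀ ℕ)) := by
    refine (Ideal.Quotient.mk_eq_mk_iff_sub_mem _ _).1 ?_
    exact congrArg Subtype.val hq'
  have h := vandermondeDual_of_mem a hmem
  rw [eq_sum_C_mul_X_of_isHomogeneous_one hp, map_sub, vandermondeDual_linear_mul, zero_sub, neg_eq_zero] at h
  exact vandermondeDual_monomial hσ h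

/-! ### Failure of the WLP and the conclusion. -/

theorem not_hasWLP_monomialIdeal_powersAndProduct (K : Type*) [Field K] (hn : 3 ≤ n) :
    ¬ HasWLP (monomialIdeal K (powersAndProduct n : Set (Fin n →₀ ℕ))) := by
  rintro ⟨ℓ, hℓ⟩
  have : NeZero n := ⟨by omega⟩
  obtain ⟨d, hd⟩ : ∃ d, 2 * (d + 1) = n * (n - 1) := by
    refine ⟨n * (n - 1) / 2 - 1, ?_⟩
    have h2 : 2 ∣ n * (n - 1) := (Nat.even_mul_pred_self n).two_dvd
    have : 3 * 2 ≤ n * (n - 1) := Nat.mul_le_mul hn (by omega)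
    omega
  obtain ⟨b⟩ := nonempty_basis_component_monomialIdeal (K := K)
    (powersAndProduct n : Set (Fin n →₀ ℕ)) d _ fun _ => mem_standardExponents
  obtain ⟨b'⟩ := nonempty_basis_component_monomialIdeal (K := K)
    (powersAndProduct n : Set (Fin n →₀ ℕ)) (d + 1) _ fun _ => mem_standardExponents
  have := Module.Finite.of_basis b
  have := Module.Finite.of_basis b'
  refine not_surjective_mulMap hd ℓ ((hℓ d).elim (fun hinj => ?_) id)
  have hle := LinearMap.finrank_le_finrank_of_injective hinj
  -- Injectivity and the non-increasing Hilbert function force equal dimensions, hence surjectivity.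
  refine (LinearMap.injective_iff_surjective_of_finrank_eq_finrank (le_antisymm hle ?_)).1 hinj
  rw [Module.finrank_eq_card_basis b, Module.finrank_eq_card_basis b', Fintype.card_coe,
    Fintype.card_coe]
  exact card_standardExponents_succ_le hn hd

theorem isArtinianACI_monomialIdeal_powersAndProduct (K : Type*) [Field K] (hn : 2 ≤ n) :
    IsArtinianACI (monomialIdeal K (powersAndProduct n : Set (Fin n →₀ ℕ))) := by
  refine ⟨⟨monomialIdeal_isHomogeneous _, ?_⟩, ?_⟩
  · exact isArtinianRing_quotient_monomialIdeal (fun _ => n) (fun _ => by omega)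
      fun i => by simp [powersAndProduct]
  · rw [spanFinrank_monomialIdeal (isAntichain_powersAndProduct hn), card_powersAndProduct hn]

end WeakLefschetz

theorem corollary4p6 (K : Type*) [Field K] (n : ℕ) (hn : 3 ≤ n) :
    (∃ I : Ideal (MvPolynomial (Fin n) K),
      WeakLefschetz.IsArtinianACI I ∧ ¬ WeakLefschetz.HasWLP I) ∧
    (∀ a : ℕ, WeakLefschetz.IsA K n a → a = n) := by
  have hACI := WeakLefschetz.isArtinianACI_monomialIdeal_powersAndProduct K (n := n) (by omega)
  have hWLP := WeakLefschetz.not_hasWLP_monomialIdeal_powersAndProduct K hn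
  refine ⟨⟨_, hACI, hWLP⟩, fun a ha => ?_⟩
  obtain ⟨hna, hup⟩ := ha.1
  by_contra hne
  exact hWLP (hup _ hACI.1 (by rw [hACI.2]; omega))
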